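/- Let $X$ be an infinite-dimensional real Banach space and let $p\in\{1,2,3,\dots\}\cup\{\infty\}$. A bump function on $X$ is a function $b:X\to\mathbb{R}$ that is not identically zero and whose support $\overline{\{x\in X: b(x)\neq 0\}}$ is bounded; smoothness and derivatives are in the sense of Fréchet. The following statements are equivalent. 1. $X$ has a $C^p$ smooth bump function. 2. There exist a bounded contractible open subset $U$ of $X$ and a continuous function $f:\overline{U}\to\mathbb{R}$ such that $f$ is $C^p$ smooth in $U$, $f=0$ on $\partial U$, and $f'(x)\neq 0$ for all $x\in U$. 3. There exist a $C^p$ smooth function $f:X\to[0,1]$ and a bounded contractible open subset $U$ of $X$ such that, for every $x\in X$, $f(x)=0$ if and only if $x\in X\setminus U$, and $f'(x)\neq 0$ for all $x\in U$. The three statements are also equivalent to one another when, in each of them, "$C^p$ smooth" is replaced by "$C^p$ smooth and Lipschitz" (in (2): $f$ is $C^p$ smooth and Lipschitz in $U$). A contractible set is in particular nonempty. -/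

import Mathlib

/-- A bump function on a real normed space: a real-valued function that is not identically zero
and whose (closed) support is bounded. -/
structure IsBump {X : Type*} [NormedAddCommGroup X] (b : X → ℝ) : Prop where
  exists_ne_zero : ∃ x, b x ≠ 0
  isBounded_tsupport : Bornology.IsBounded (tsupport b)

/-!
The implication from the third statement to the second is immediate. From the second to the first,
the function is extended by zero and composed with a smooth function of one variable vanishing near
`0` (`exists_isBump_of_frontier`); a Lipschitz constant survives since every segment leaving `U`
crosses its frontier.

The substance is the passage from a bump function to a function on a tube without critical points.
Write `X = ℂ ⊕ K` with `K = ker ζ` (`exists_complex_coordinate`). In `K` there is a bounded smooth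
Lipschitz path `W` which never comes back near a point it occupied an integer time earlier
(`exists_separated_path`): it runs along the segments between consecutive vectors of a bounded
triangular biorthogonal sequence, which exists because `X` has infinite dimension. While `W` runs
through `K`, let the complex coordinate turn once around the annulus `e⁻¹ < |ζ| < e` in each unit of
time. The points `(exp v, W v + h)`, with `|re v| < 1`, `im v > 0` and `h` small in `K`, fill a
bounded open set, an infinitely long helical tube, and the separation of `W` makes the coordinates
`(v, h)` injective and locally finite, so that the turns of the
tube do not accumulate anywhere (`HelicalTube.exists_branch`). On it the function

  `intervalCutoff (re v) * expNegInvGlue (im v) * φ h`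

is `C^p`, extends by zero to `X`, and has no critical point because it increases with `im v`
(`HelicalTube.fderiv_toFun_ne_zero`). Since the turning rate and the speed of `W` are bounded, it is
Lipschitz when `φ` is.

For the tube to be contractible the bump function `φ` has to be positive on a star-shaped set; such
a `φ` is obtained from an arbitrary bump function by averaging along rays
(`IsBump.exists_starShaped`). The tube is then homeomorphic to a star-shaped set of coordinates.
-/

open Set Filter Topology MeasureTheory
open scoped NNReal ContDiff

/-! ### Cutoff functions of one real variable -/

theorem LipschitzWith.mul_of_mem_Icc {α : Type*} [PseudoMetricSpace α] {f g : α → ℝ} {K L : ℝ≥0}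
    (hf : LipschitzWith K f) (hg : LipschitzWith L g) (hf1 : ∀ x, f x ∈ Icc (0 : ℝ) 1)
    (hg1 : ∀ x, g x ∈ Icc (0 : ℝ) 1) : LipschitzWith (K + L) fun x => f x * g x := by
  refine LipschitzWith.of_dist_le_mul fun x y => ?_
  have h1 := hf.dist_le_mul x y
  have h2 := hg.dist_le_mul x y
  rw [Real.dist_eq] at *
  have e : f x * g x - f y * g y = (f x - f y) * g x + f y * (g x - g y) := by ring
  rw [e, NNReal.coe_add, add_mul]
  refine (abs_add_le _ _).trans (add_le_add ?_ ?_)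
  · rw [abs_mul, abs_of_nonneg (hg1 x).1]
    exact (mul_le_of_le_one_right (abs_nonneg _) (hg1 x).2).trans h1
  · rw [abs_mul, abs_of_nonneg (hf1 y).1]
    exact (mul_le_of_le_one_left (abs_nonneg _) (hf1 y).2).trans h2

theorem Real.smoothTransition.mem_Icc (x : ℝ) : smoothTransition x ∈ Icc (0 : ℝ) 1 :=
  ⟨smoothTransition.nonneg x, smoothTransition.le_one x⟩

theorem Real.smoothTransition.ne_zero_iff {x : ℝ} : smoothTransition x ≠ 0 ↔ 0 < x := by
  rw [Ne, smoothTransition.zero_iff_nonpos, not_le]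

theorem Real.smoothTransition.exists_lipschitzWith : ∃ K, LipschitzWith K smoothTransition := by
  have hd : ContDiff ℝ 1 smoothTransition := smoothTransition.contDiff (n := 1)
  have hsupp : HasCompactSupport (deriv smoothTransition) := by
    refine HasCompactSupport.intro (isCompact_Icc (a := (0 : ℝ)) (b := 1)) fun x hx => ?_
    rw [Set.mem_Icc, not_and_or, not_le, not_le] at hx
    rcases hx with hx | hx
    · have : smoothTransition =ᶠ[𝓝 x] fun _ => (0 : ℝ) := by
        filter_upwards [gt_mem_nhds hx] with y hy using smoothTransition.zero_of_nonpos hy.le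
      rw [this.deriv_eq, deriv_const]
    · have : smoothTransition =ᶠ[𝓝 x] fun _ => (1 : ℝ) := by
        filter_upwards [lt_mem_nhds hx] with y hy using smoothTransition.one_of_one_le hy.le
      rw [this.deriv_eq, deriv_const]
  obtain ⟨C, hC⟩ := hsupp.exists_bound_of_continuous (hd.continuous_deriv le_rfl)
  refine ⟨(max C 0).toNNReal,
    lipschitzWith_of_nnnorm_deriv_le (hd.differentiable one_ne_zero) fun x => ?_⟩
  rw [← NNReal.coe_le_coe, Real.coe_toNNReal _ (le_max_right _ _)]
  exact (hC x).trans (le_max_left _ _)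

theorem expNegInvGlue.hasDerivAt (x : ℝ) :
    HasDerivAt expNegInvGlue (x⁻¹ ^ 2 * expNegInvGlue x) x := by
  simpa using expNegInvGlue.hasDerivAt_polynomial_eval_inv_mul 1 x

theorem expNegInvGlue.mem_Icc (x : ℝ) : expNegInvGlue x ∈ Icc (0 : ℝ) 1 := by
  refine ⟨expNegInvGlue.nonneg x, ?_⟩
  unfold expNegInvGlue
  split_ifs with h
  · exact zero_le_one
  · rw [Real.exp_le_one_iff]
    have := inv_pos.2 (not_le.1 h)
    linarith

theorem expNegInvGlue.lipschitzWith : LipschitzWith 2 expNegInvGlue := by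
  refine lipschitzWith_of_nnnorm_deriv_le (fun x => (hasDerivAt x).differentiableAt) fun x => ?_
  rw [(hasDerivAt x).deriv, ← NNReal.coe_le_coe, coe_nnnorm, Real.norm_eq_abs,
    abs_of_nonneg (mul_nonneg (sq_nonneg _) (nonneg x))]
  rcases le_or_gt x 0 with hx | hx
  · simp [zero_of_nonpos hx]
  · have hy := inv_pos.2 hx
    have h := Real.quadratic_le_exp_of_nonneg hy.le
    rw [expNegInvGlue, if_neg hx.not_ge, Real.exp_neg, ← div_eq_mul_inv,
      div_le_iff₀ (Real.exp_pos _)]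
    push_cast
    nlinarith

/-- The smooth cutoff `v ↦ smoothTransition (1 - v ^ 2)`, positive exactly on `(-1, 1)`. -/
noncomputable def intervalCutoff (v : ℝ) : ℝ := Real.smoothTransition (1 - v ^ 2)

theorem intervalCutoff_mem_Icc (v : ℝ) : intervalCutoff v ∈ Icc (0 : ℝ) 1 :=
  Real.smoothTransition.mem_Icc _

theorem intervalCutoff_ne_zero_iff {v : ℝ} : intervalCutoff v ≠ 0 ↔ |v| < 1 := by
  rw [intervalCutoff, Real.smoothTransition.ne_zero_iff, sub_pos, sq_lt_one_iff_abs_lt_one]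

theorem contDiff_intervalCutoff {n : ℕ∞} : ContDiff ℝ n intervalCutoff :=
  Real.smoothTransition.contDiff.comp (contDiff_const.sub (contDiff_id.pow 2))

theorem exists_lipschitzWith_intervalCutoff : ∃ K, LipschitzWith K intervalCutoff := by
  refine ContDiff.lipschitzWith_of_hasCompactSupport (𝕂 := ℝ) (n := 1) ?_
    (contDiff_intervalCutoff (n := 1)) one_ne_zero
  refine HasCompactSupport.intro (isCompact_Icc (a := (-1 : ℝ)) (b := 1)) fun v hv => ?_
  by_contra h
  exact hv (abs_le.1 (intervalCutoff_ne_zero_iff.1 h).le)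

/-! ### Bump functions with star-shaped support -/

section Construction

variable {X : Type*} [NormedAddCommGroup X] [NormedSpace ℝ X]

/-- Integrating over a compact interval preserves `C^p` dependence on a parameter: up to a smooth
cutoff in the integration variable, the integral is a convolution with the indicator function of
the interval. -/
theorem contDiff_intervalIntegral_param {p : ℕ∞} {g : X → ℝ → ℝ} {T : ℝ} (hT : 0 < T)
    (hg : ContDiff ℝ p (fun q : X × ℝ => g q.1 q.2)) :
    ContDiff ℝ p fun x => ∫ t in (0 : ℝ)..T, g x t := by
  -- `κ` equals `1` on `[-T, 0]`, so that multiplying by it does not change the convolution at `0`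
  let κ : ContDiffBump (0 : ℝ) := ⟨T, T + 1, hT, by linarith⟩
  let G : X → ℝ → ℝ := fun x s => κ s * g x (-s)
  have hG : ContDiffOn ℝ p (fun q : X × ℝ => G q.1 q.2) (univ ×ˢ univ) := by
    refine ContDiff.contDiffOn ?_
    exact ((κ.contDiff (n := p)).comp contDiff_snd).mul
      (hg.comp (contDiff_fst.prodMk contDiff_snd.neg))
  have hf : LocallyIntegrable ((Ioc 0 T).indicator fun _ => (1 : ℝ)) volume :=
    ((integrable_indicator_iff measurableSet_Ioc).2
      (integrableOn_const (by simp) (by simp))).locallyIntegrable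
  have key := contDiffOn_convolution_right_with_param_comp (ContinuousLinearMap.mul ℝ ℝ)
    (v := fun _ : X => (0 : ℝ)) (g := G) (μ := volume) (k := Metric.closedBall (0 : ℝ) (T + 1))
    contDiffOn_const isOpen_univ (isCompact_closedBall _ _) ?_ hf hG
  · rw [← contDiffOn_univ]
    convert key using 2 with x
    rw [convolution_def, intervalIntegral.integral_of_le hT.le, ← integral_indicator
      measurableSet_Ioc]
    refine integral_congr_ae (ae_of_all _ fun t => ?_)
    by_cases ht : t ∈ Ioc 0 T
    · have : κ (-t) = 1 := κ.one_of_mem_closedBall (by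
        simpa [abs_of_pos ht.1] using ht.2)
      simp [ht, G, this]
    · simp [ht]
  · intro x s _ hs
    have : κ s = 0 := κ.zero_of_le_dist (by
      rw [Metric.mem_closedBall, not_le] at hs; exact hs.le)
    simp [G, this]

/-- From a bump function `b` one obtains a bump function with values in `[0, 1]`, equal to `1` near
the origin. -/
theorem IsBump.exists_eq_one_near_zero {b : X → ℝ} (hb : IsBump b) {p : ℕ∞}
    (hbp : ContDiff ℝ p b) :
    ∃ c : X → ℝ, ContDiff ℝ p c ∧ (∀ x, c x ∈ Icc (0 : ℝ) 1) ∧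
      (∃ δ > 0, ∀ x, ‖x‖ ≤ δ → c x = 1) ∧ (∃ R, ∀ x, R ≤ ‖x‖ → c x = 0) ∧
      ((∃ K, LipschitzWith K b) → ∃ K, LipschitzWith K c) := by
  obtain ⟨a, ha⟩ := hb.exists_ne_zero
  obtain ⟨M, hM⟩ := hb.isBounded_tsupport.exists_norm_le
  have haff : ContDiff ℝ p fun x => 2 / b a * b (x + a) :=
    contDiff_const.mul (hbp.comp (contDiff_id.add contDiff_const))
  refine ⟨fun x => Real.smoothTransition (2 / b a * b (x + a)),
    Real.smoothTransition.contDiff.comp haff, fun x => Real.smoothTransition.mem_Icc _, ?_,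
    ⟨M + ‖a‖ + 1, fun x hx => ?_⟩, ?_⟩
  · have h2 : ∀ᶠ x in 𝓝 (0 : X), 1 < 2 / b a * b (x + a) := by
      refine haff.continuous.continuousAt.eventually (lt_mem_nhds ?_)
      simp only [zero_add]
      rw [div_mul_cancel₀ _ ha]
      norm_num
    obtain ⟨δ, hδ, h⟩ := Metric.eventually_nhds_iff_ball.1 h2
    refine ⟨δ / 2, half_pos hδ, fun x hx => Real.smoothTransition.one_of_one_le (h x ?_).le⟩
    rw [mem_ball_zero_iff]
    linarith
  · have : b (x + a) = 0 := by
      by_contra h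
      have h1 := hM _ (subset_tsupport b h)
      have h2 := norm_sub_le (x + a) a
      rw [add_sub_cancel_right] at h2
      linarith
    simp [this]
  · rintro ⟨K, hK⟩
    obtain ⟨L, hL⟩ := Real.smoothTransition.exists_lipschitzWith
    refine ⟨_, hL.comp ((lipschitzWith_smul (2 / b a)).comp (hK.comp
      (isometry_add_right a).lipschitz))⟩

/-- A space with a `C^p` bump function has `C^p` bump functions supported in arbitrarily small
balls around the origin whose nonvanishing set is star-shaped. Averaging a bump function `c` along
rays, `J x = ∫ t in 0..T, c (t • x)`, gives a function which is positively homogeneous of degree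
`-1` away from a small ball on which `J ≥ 2`, so that `{J > 1}` is star-shaped. -/
theorem IsBump.exists_starShaped {b : X → ℝ} (hb : IsBump b) {p : ℕ∞}
    (hbp : ContDiff ℝ p b) {r : ℝ} (hr : 0 < r) :
    ∃ φ : X → ℝ, ContDiff ℝ p φ ∧ (∀ x, φ x ∈ Icc (0 : ℝ) 1) ∧ φ 0 ≠ 0 ∧
      (∀ x, φ x ≠ 0 → ‖x‖ < r) ∧
      (∀ x, φ x ≠ 0 → ∀ s : ℝ, 0 < s → s ≤ 1 → φ (s • x) ≠ 0) ∧
      ((∃ K, LipschitzWith K b) → ∃ K, LipschitzWith K φ) := by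
  obtain ⟨c, hcp, hc01, ⟨δ₀, hδ₀, hc1⟩, ⟨R₀, hc0⟩, hcl⟩ := hb.exists_eq_one_near_zero hbp
  obtain ⟨R, δ, hδ, hδR, hcδ, hcR⟩ : ∃ R δ : ℝ, 0 < δ ∧ δ ≤ R ∧ (∀ x, ‖x‖ ≤ δ → c x = 1) ∧
      ∀ x, R ≤ ‖x‖ → c x = 0 :=
    ⟨max R₀ δ₀, δ₀, hδ₀, le_max_right _ _, hc1, fun x hx => hc0 x ((le_max_left _ _).trans hx)⟩
  have hR : 0 < R := hδ.trans_le hδR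
  -- with this `T`, the argument `t • x` leaves the support before `t = T` once `δ / 2 ≤ ‖x‖`
  set T : ℝ := 2 * R / δ with hTdef
  have hT2 : 2 ≤ T := by rw [hTdef, le_div_iff₀ hδ]; linarith
  have hT : 0 < T := by linarith
  have hTδ : T * (δ / 2) = R := by rw [hTdef]; field_simp
  have hcont : ∀ x : X, Continuous fun t : ℝ => c (t • x) := fun x =>
    hcp.continuous.comp (continuous_id.smul continuous_const)
  have hint : ∀ (x : X) (a b : ℝ), IntervalIntegrable (fun t : ℝ => c (t • x)) volume a b :=
    fun x a b => (hcont x).intervalIntegrable a b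
  let J : X → ℝ := fun x => ∫ t in (0 : ℝ)..T, c (t • x)
  have hJp : ContDiff ℝ p J :=
    contDiff_intervalIntegral_param hT (hcp.comp (contDiff_snd.smul contDiff_fst))
  have hJsmall : ∀ x, ‖x‖ ≤ δ / 2 → 2 ≤ J x := by
    intro x hx
    have h1 : ∫ t in (0 : ℝ)..2, c (t • x) = 2 := by
      rw [intervalIntegral.integral_congr (g := fun _ => (1 : ℝ))]
      · simp
      · intro t ht
        rw [uIcc_of_le zero_le_two] at ht
        refine hcδ _ ?_
        rw [norm_smul, Real.norm_of_nonneg ht.1]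
        nlinarith [ht.1, ht.2, norm_nonneg x]
    rw [← h1]
    exact intervalIntegral.integral_mono_interval le_rfl zero_le_two hT2
      (ae_of_all _ fun t => (hc01 _).1) (hint x 0 T)
  have hJzero : ∀ (x : X) (a : ℝ), 0 ≤ a → a ≤ T → R ≤ a * ‖x‖ →
      J x = ∫ t in (0 : ℝ)..a, c (t • x) := by
    intro x a ha haT hax
    have h1 : ∫ t in a..T, c (t • x) = 0 := by
      rw [intervalIntegral.integral_congr (g := fun _ => (0 : ℝ))]
      · simp
      · intro t ht
        rw [uIcc_of_le haT] at ht
        refine hcR _ ?_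
        rw [norm_smul, Real.norm_of_nonneg (ha.trans ht.1)]
        exact hax.trans (mul_le_mul_of_nonneg_right ht.1 (norm_nonneg x))
    have h2 := intervalIntegral.integral_add_adjacent_intervals (hint x 0 a) (hint x a T)
    rw [h1, add_zero] at h2
    exact h2.symm
  have hJbig : ∀ x, 1 < J x → ‖x‖ < R := by
    intro x hx
    by_contra h
    rw [hJzero x 1 zero_le_one (by linarith) (by linarith)] at hx
    have : ∫ t in (0 : ℝ)..1, c (t • x) ≤ ∫ t in (0 : ℝ)..1, (1 : ℝ) :=
      intervalIntegral.integral_mono_on zero_le_one (hint x 0 1) (by simp) fun t _ => (hc01 _).2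
    simp at this
    linarith
  have hJstar : ∀ x, 1 < J x → ∀ s : ℝ, 0 < s → s ≤ 1 → 1 < J (s • x) := by
    intro x hx s hs hs1
    rcases le_or_gt ‖s • x‖ (δ / 2) with h | h
    · linarith [hJsmall _ h]
    · have h1 : J (s • x) = s⁻¹ * J x := by
        have h2 : J (s • x) = ∫ t in (0 : ℝ)..T, c ((t * s) • x) := by
          simp only [J, smul_smul]
        rw [h2, intervalIntegral.integral_comp_mul_right (fun t => c (t • x)) hs.ne', zero_mul,
          smul_eq_mul, hJzero x (T * s) (by positivity) (by nlinarith) ?_]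
        rw [norm_smul, Real.norm_of_nonneg hs.le] at h
        nlinarith
      rw [h1]
      have := (one_le_inv₀ hs).2 hs1
      nlinarith
  have hφ : ∀ x, Real.smoothTransition (J x - 1) ≠ 0 ↔ 1 < J x := fun x => by
    rw [Real.smoothTransition.ne_zero_iff, sub_pos]
  have hRr : 0 < R / r := div_pos hR hr
  refine ⟨fun x => Real.smoothTransition (J ((R / r) • x) - 1), ?_, fun x =>
    Real.smoothTransition.mem_Icc _, ?_, ?_, ?_, ?_⟩
  · exact Real.smoothTransition.contDiff.comp
      ((hJp.comp (contDiff_const_smul _)).sub contDiff_const)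
  · rw [hφ]
    refine one_lt_two.trans_le (hJsmall _ ?_)
    rw [smul_zero, norm_zero]
    exact (half_pos hδ).le
  · intro x hx
    have h := hJbig _ ((hφ _).1 hx)
    rw [norm_smul, Real.norm_of_nonneg hRr.le, div_mul_eq_mul_div, div_lt_iff₀ hr] at h
    exact lt_of_mul_lt_mul_left h hR.le
  · intro x hx s hs hs1
    beta_reduce
    rw [smul_comm]
    exact (hφ _).2 (hJstar _ ((hφ _).1 hx) s hs hs1)
  · intro hbl
    obtain ⟨K, hK⟩ := hcl hbl
    obtain ⟨L, hL⟩ := Real.smoothTransition.exists_lipschitzWith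
    have hJl : LipschitzWith (K * T.toNNReal * T.toNNReal) J := by
      refine LipschitzWith.of_dist_le_mul fun x y => ?_
      rw [dist_eq_norm, ← intervalIntegral.integral_sub (hint x 0 T) (hint y 0 T)]
      refine (intervalIntegral.norm_integral_le_of_norm_le_const (C := K * T * dist x y)
        fun t ht => ?_).trans (le_of_eq ?_)
      · rw [uIoc_of_le hT.le] at ht
        rw [← dist_eq_norm]
        refine (hK.dist_le_mul _ _).trans ?_
        rw [dist_smul₀, Real.norm_of_nonneg ht.1.le, mul_assoc]
        gcongr
        exact ht.2
      · rw [sub_zero, abs_of_pos hT]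
        push_cast
        rw [Real.coe_toNNReal _ hT.le]
        ring
    exact ⟨_, hL.comp ((hJl.comp (lipschitzWith_smul (R / r))).sub (LipschitzWith.const 1))⟩

/-! ### Triangular biorthogonal sequences -/

/-- Outside a finite-dimensional subspace `F` of an infinite-dimensional space there is a vector of
norm at most `2` on which some functional of norm at most `1` vanishing on `F` takes the
value `1`. -/
theorem exists_dual_eq_one_of_finiteDimensional (hX : ¬ FiniteDimensional ℝ X)
    (F : Submodule ℝ X) [FiniteDimensional ℝ F] :
    ∃ (x : X) (g : X →L[ℝ] ℝ), ‖x‖ ≤ 2 ∧ g x = 1 ∧ ‖g‖ ≤ 1 ∧ ∀ y ∈ F, g y = 0 := by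
  have hF : F ≠ ⊤ := by
    rintro rfl
    exact hX (Module.finite_def.2 (Module.Finite.iff_fg.1 ‹_›))
  have : IsClosed (F : Set X) := F.closed_of_finiteDimensional
  have : Nontrivial (X ⧸ F) := Submodule.Quotient.nontrivial_iff.2 hF
  obtain ⟨q, hq⟩ := exists_norm_eq (X ⧸ F) zero_le_one
  obtain ⟨g, hg, hgq⟩ := exists_dual_vector ℝ q (by rw [hq]; exact one_ne_zero)
  obtain ⟨x, hxq, hx⟩ := Submodule.Quotient.norm_mk_lt q one_pos
  let G : X →L[ℝ] ℝ := (g : (X ⧸ F) →ₗ[ℝ] ℝ).comp F.mkQ |>.mkContinuous 1 fun y => by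
    rw [one_mul]
    refine (g.le_opNorm (F.mkQ y)).trans ?_
    rw [hg, one_mul]
    exact Submodule.Quotient.norm_mk_le F y
  refine ⟨x, G, by linarith, ?_, LinearMap.mkContinuous_norm_le _ zero_le_one _, fun y hy => ?_⟩
  · change g (Submodule.Quotient.mk x) = 1
    rw [hxq, hgq, hq]
    rfl
  · change g (Submodule.Quotient.mk y) = 0
    rw [(Submodule.Quotient.mk_eq_zero F).2 hy, map_zero]

/-- A triangular biorthogonal sequence in the complement of a given finite-dimensional subspace. -/
theorem exists_triangular_biorthogonal (hX : ¬ FiniteDimensional ℝ X)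
    (F : Submodule ℝ X) [FiniteDimensional ℝ F] :
    ∃ (e : ℕ → X) (g : ℕ → X →L[ℝ] ℝ), (∀ n, ‖e n‖ ≤ 2) ∧ (∀ n, g n (e n) = 1) ∧
      (∀ n, ‖g n‖ ≤ 1) ∧ (∀ n, ∀ y ∈ F, g n y = 0) ∧ ∀ m n, m < n → g n (e m) = 0 := by
  classical
  obtain ⟨a, ha, har⟩ := exists_seq_of_forall_finset_exists
    (fun a : X × (X →L[ℝ] ℝ) => ‖a.1‖ ≤ 2 ∧ a.2 a.1 = 1 ∧ ‖a.2‖ ≤ 1 ∧ ∀ y ∈ F, a.2 y = 0)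
    (fun a b => b.2 a.1 = 0) fun s _ => by
      have : FiniteDimensional ℝ (Submodule.span ℝ (s.image Prod.fst : Set X)) :=
        FiniteDimensional.span_finset ℝ _
      obtain ⟨x, g, hx, hgx, hg, hgF⟩ := exists_dual_eq_one_of_finiteDimensional hX
        (F ⊔ Submodule.span ℝ (s.image Prod.fst : Set X))
      refine ⟨(x, g), ⟨hx, hgx, hg, fun y hy => hgF y (Submodule.mem_sup_left hy)⟩, fun b hb =>
        hgF _ (Submodule.mem_sup_right (Submodule.subset_span ?_))⟩
      exact Finset.mem_coe.2 (Finset.mem_image_of_mem _ hb)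
  exact ⟨fun n => (a n).1, fun n => (a n).2, fun n => (ha n).1, fun n => (ha n).2.1,
    fun n => (ha n).2.2.1, fun n => (ha n).2.2.2, har⟩

/-- An infinite-dimensional real normed space contains a complemented copy of `ℂ`. -/
theorem exists_complex_coordinate (hX : ¬ FiniteDimensional ℝ X) :
    ∃ (ζ : X →L[ℝ] ℂ) (j : ℂ →L[ℝ] X), ∀ c, ζ (j c) = c := by
  obtain ⟨e, g, -, he, -, -, heg⟩ := exists_triangular_biorthogonal hX ⊥
  have h01 := heg 0 1 one_pos
  refine ⟨(g 0 - g 0 (e 1) • g 1).smulRight (1 : ℂ) + (g 1).smulRight Complex.I,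
    Complex.reCLM.smulRight (e 0) + Complex.imCLM.smulRight (e 1), fun c => ?_⟩
  apply Complex.ext
  · simp [he, h01, mul_comm]
  · simp [he, h01]

/-! ### A path without accumulation points -/

/-- The smooth path which runs along the segment from `e n` to `e (n + 1)` in the time interval
`[n, n + 1]`, pausing to infinite order at the vertices, and which rests at `e 0` in negative
time. -/
noncomputable def vertexPath (e : ℕ → X) (t : ℝ) : X :=
  e ⌊t⌋₊ + Real.smoothTransition (t - ⌊t⌋₊) • (e (⌊t⌋₊ + 1) - e ⌊t⌋₊)

/-- Around the vertex `e n`, the path is a single smooth expression. For `n = 0` the truncated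
index `n - 1` makes the middle term vanish. -/
theorem vertexPath_eq (e : ℕ → X) {n : ℕ} {t : ℝ} (ht : t < n + 1) (ht' : n - 1 < t ∨ n = 0) :
    vertexPath e t = e (n - 1) + Real.smoothTransition (t - n + 1) • (e n - e (n - 1)) +
      Real.smoothTransition (t - n) • (e (n + 1) - e n) := by
  rcases le_or_gt (n : ℝ) t with h | h
  · have hfl : ⌊t⌋₊ = n := (Nat.floor_eq_iff ((Nat.cast_nonneg n).trans h)).2 ⟨h, ht⟩
    rw [vertexPath, hfl, Real.smoothTransition.one_of_one_le (x := t - n + 1) (by linarith)]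
    simp
  · rw [Real.smoothTransition.zero_of_nonpos (x := t - n) (by linarith)]
    rcases n with _ | n
    · have hfl : ⌊t⌋₊ = 0 := Nat.floor_of_nonpos (by exact_mod_cast h.le)
      rw [vertexPath, hfl, Real.smoothTransition.zero_of_nonpos
        (x := t - ((0 : ℕ) : ℝ)) (by linarith)]
      simp
    · push_cast at h ht'
      have hnt : (n : ℝ) < t := by
        rcases ht' with h' | h'
        · linarith
        · exact h'.elim
      have hfl : ⌊t⌋₊ = n :=
        (Nat.floor_eq_iff ((Nat.cast_nonneg n).trans hnt.le)).2 ⟨hnt.le, h⟩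
      have hsub : t - ((n + 1 : ℕ) : ℝ) + 1 = t - n := by push_cast; ring
      rw [vertexPath, hfl, hsub]
      simp

theorem vertexPath_eventuallyEq (e : ℕ → X) (t₀ : ℝ) : ∃ n : ℕ, vertexPath e =ᶠ[𝓝 t₀] fun t : ℝ =>
    e (n - 1) + Real.smoothTransition (t - n + 1) • (e n - e (n - 1)) +
      Real.smoothTransition (t - n) • (e (n + 1) - e n) := by
  refine ⟨⌊t₀⌋₊, ?_⟩
  have h1 : ∀ᶠ t : ℝ in 𝓝 t₀, t < ⌊t₀⌋₊ + 1 := gt_mem_nhds (Nat.lt_floor_add_one t₀)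
  have h2 : ∀ᶠ t : ℝ in 𝓝 t₀, (⌊t₀⌋₊ - 1 : ℝ) < t ∨ ⌊t₀⌋₊ = 0 := by
    rcases le_or_gt 0 t₀ with h | h
    · have h3 : (⌊t₀⌋₊ - 1 : ℝ) < t₀ := by linarith [Nat.floor_le h]
      filter_upwards [lt_mem_nhds h3] with t ht using Or.inl ht
    · exact Eventually.of_forall fun t => Or.inr (Nat.floor_of_nonpos h.le)
  filter_upwards [h1, h2] with t ht ht' using vertexPath_eq e ht ht'

theorem contDiff_vertexPath (e : ℕ → X) {p : ℕ∞} : ContDiff ℝ p (vertexPath e) := by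
  rw [contDiff_iff_contDiffAt]
  intro t₀
  obtain ⟨n, hn⟩ := vertexPath_eventuallyEq e t₀
  refine ContDiffAt.congr_of_eventuallyEq (ContDiff.contDiffAt ?_) hn
  have h1 : ContDiff ℝ p fun t : ℝ => Real.smoothTransition (t - n + 1) :=
    Real.smoothTransition.contDiff.comp ((contDiff_id.sub contDiff_const).add contDiff_const)
  have h2 : ContDiff ℝ p fun t : ℝ => Real.smoothTransition (t - n) :=
    Real.smoothTransition.contDiff.comp (contDiff_id.sub contDiff_const)
  exact (contDiff_const.add (h1.smul contDiff_const)).add (h2.smul contDiff_const)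

theorem norm_sub_le_two_mul {E : Type*} [SeminormedAddCommGroup E] {x y : E} {M : ℝ}
    (hx : ‖x‖ ≤ M) (hy : ‖y‖ ≤ M) :
    ‖x - y‖ ≤ 2 * M := (norm_sub_le x y).trans (by linarith)

theorem norm_vertexPath_le {e : ℕ → X} {M : ℝ} (he : ∀ n, ‖e n‖ ≤ M) (t : ℝ) :
    ‖vertexPath e t‖ ≤ 3 * M := by
  refine (norm_add_le _ _).trans ?_
  rw [norm_smul, Real.norm_of_nonneg (Real.smoothTransition.nonneg _)]
  have h1 := norm_sub_le_two_mul (he (⌊t⌋₊ + 1)) (he ⌊t⌋₊)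
  have h2 := mul_le_of_le_one_left (norm_nonneg (e (⌊t⌋₊ + 1) - e ⌊t⌋₊))
    (Real.smoothTransition.le_one (t - ⌊t⌋₊))
  linarith [he ⌊t⌋₊]

theorem exists_lipschitzWith_vertexPath {e : ℕ → X} {M : ℝ} (he : ∀ n, ‖e n‖ ≤ M) :
    ∃ K, LipschitzWith K (vertexPath e) := by
  obtain ⟨L, hL⟩ := Real.smoothTransition.exists_lipschitzWith
  have hM : 0 ≤ M := (norm_nonneg _).trans (he 0)
  refine ⟨(4 * M).toNNReal * L, lipschitzWith_of_nnnorm_fderiv_le (𝕜 := ℝ)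
    ((contDiff_vertexPath e (p := 1)).differentiable one_ne_zero) fun t₀ => ?_⟩
  obtain ⟨n, hn⟩ := vertexPath_eventuallyEq e t₀
  rw [hn.fderiv_eq, ← NNReal.coe_le_coe, coe_nnnorm]
  refine norm_fderiv_le_of_lipschitz ℝ (LipschitzWith.of_dist_le_mul fun s t => ?_)
  have h1 := hL.dist_le_mul (s - n + 1) (t - n + 1)
  have h2 := hL.dist_le_mul (s - n) (t - n)
  rw [dist_add_right, dist_sub_right] at h1
  rw [dist_sub_right] at h2
  rw [Real.dist_eq] at h1 h2
  rw [dist_eq_norm]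
  have e1 : e (n - 1) + Real.smoothTransition (s - n + 1) • (e n - e (n - 1)) +
      Real.smoothTransition (s - n) • (e (n + 1) - e n) -
      (e (n - 1) + Real.smoothTransition (t - n + 1) • (e n - e (n - 1)) +
      Real.smoothTransition (t - n) • (e (n + 1) - e n)) =
      (Real.smoothTransition (s - n + 1) - Real.smoothTransition (t - n + 1)) •
        (e n - e (n - 1)) +
      (Real.smoothTransition (s - n) - Real.smoothTransition (t - n)) • (e (n + 1) - e n) := by
    simp only [sub_smul]
    abel
  rw [e1]
  refine (norm_add_le _ _).trans ?_
  rw [norm_smul, norm_smul, Real.norm_eq_abs, Real.norm_eq_abs, NNReal.coe_mul,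
    Real.coe_toNNReal _ (by positivity)]
  have h3 := mul_le_mul h1 (norm_sub_le_two_mul (he n) (he (n - 1))) (norm_nonneg _)
    (by positivity)
  have h4 := mul_le_mul h2 (norm_sub_le_two_mul (he (n + 1)) (he n)) (norm_nonneg _)
    (by positivity)
  linarith

/-- Over a triangular biorthogonal sequence, points of the path at times differing by a positive
integer are uniformly separated: with `s` the common value of the cutoff at both times, the two
functionals dual to the end points of the later segment bound the distance below by `s` and by
`1 - (1 + 2 * M) * s`. -/
theorem le_norm_vertexPath_sub {e : ℕ → X} {g : ℕ → X →L[ℝ] ℝ} {M : ℝ} (he : ∀ n, ‖e n‖ ≤ M)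
    (hge : ∀ n, g n (e n) = 1) (hg : ∀ n, ‖g n‖ ≤ 1) (htri : ∀ m n, m < n → g n (e m) = 0)
    {t : ℝ} (ht : 0 ≤ t) {k : ℕ} (hk : 0 < k) :
    1 / (2 + 2 * M) ≤ ‖vertexPath e (t + k) - vertexPath e t‖ := by
  have hM : 0 ≤ M := (norm_nonneg _).trans (he 0)
  have hgn : ∀ n x, |g n x| ≤ ‖x‖ := fun n x => by
    have := (g n).le_of_opNorm_le (hg n) x
    rwa [one_mul] at this
  rw [vertexPath, vertexPath, Nat.floor_add_natCast ht]
  have hs : t + (k : ℝ) - ((⌊t⌋₊ + k : ℕ) : ℝ) = t - ⌊t⌋₊ := by push_cast; ring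
  rw [hs]
  set s := Real.smoothTransition (t - ⌊t⌋₊)
  have hs0 : 0 ≤ s := Real.smoothTransition.nonneg _
  set n := ⌊t⌋₊
  set D := e (n + k) + s • (e (n + k + 1) - e (n + k)) - (e n + s • (e (n + 1) - e n))
  have h1 : g (n + k + 1) D = s := by
    simp only [D, map_sub, map_add, map_smul, smul_eq_mul, hge]
    rw [htri (n + k) _ (by omega), htri n _ (by omega), htri (n + 1) _ (by omega)]
    ring
  have h2 : g (n + k) D =
      1 - s + s * g (n + k) (e (n + k + 1)) - s * g (n + k) (e (n + 1)) := by
    simp only [D, map_sub, map_add, map_smul, smul_eq_mul, hge]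
    rw [htri n _ (by omega)]
    ring
  have h3 := (le_abs_self _).trans (hgn (n + k + 1) D)
  have h4 := (le_abs_self _).trans (hgn (n + k) D)
  rw [h1] at h3
  rw [h2] at h4
  have h5 := mul_le_mul_of_nonneg_left ((abs_le.1 (hgn (n + k) (e (n + k + 1)))).1) hs0
  have h6 := mul_le_mul_of_nonneg_left ((abs_le.1 (hgn (n + k) (e (n + 1)))).2) hs0
  have h7 := mul_le_mul_of_nonneg_left (he (n + k + 1)) hs0
  have h8 := mul_le_mul_of_nonneg_left (he (n + 1)) hs0
  rw [div_le_iff₀ (by linarith)]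
  nlinarith [mul_le_mul_of_nonneg_left h3 hM]

open Complex Real in
/-- In an infinite-dimensional space, complemented as `ℂ ⊕ ker ζ`, there is a smooth path in
`ker ζ`, bounded and Lipschitz, here written as a function of the imaginary part of a complex
variable, whose values at different logarithms of the same number are uniformly separated. -/
theorem exists_separated_path (hX : ¬ FiniteDimensional ℝ X) {ζ : X →L[ℝ] ℂ} {j : ℂ →L[ℝ] X}
    (hζj : ∀ c, ζ (j c) = c) :
    ∃ W : ℂ → X, (∀ v, ζ (W v) = 0) ∧ (∀ p : ℕ∞, ContDiff ℝ p W) ∧ (∃ M, ∀ v, ‖W v‖ ≤ M) ∧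
      (∃ K, LipschitzWith K W) ∧
      ∃ r > 0, ∀ v v' : ℂ, exp v = exp v' → -(2 * π) ≤ v.im → -(2 * π) ≤ v'.im → v ≠ v' →
        4 * r ≤ ‖W v - W v'‖ := by
  have : FiniteDimensional ℝ (LinearMap.range (j : ℂ →ₗ[ℝ] X)) := inferInstance
  obtain ⟨e, g, he, hge, hg, hgF, htri⟩ :=
    exists_triangular_biorthogonal hX (LinearMap.range (j : ℂ →ₗ[ℝ] X))
  have hgj : ∀ n c, g n (j c) = 0 := fun n c => hgF n _ ⟨c, rfl⟩
  let P : X →L[ℝ] X := ContinuousLinearMap.id ℝ X - j.comp ζ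
  have hP : ∀ x, P x = x - j (ζ x) := fun x => rfl
  have hζP : ∀ x, ζ (P x) = 0 := fun x => by rw [hP, map_sub, hζj, sub_self]
  let e' : ℕ → X := fun n => P (e n)
  have hge' : ∀ m n, g m (e' n) = g m (e n) := fun m n => by
    simp only [e', hP, map_sub, hgj, sub_zero]
  have he' : ∀ n, ‖e' n‖ ≤ ‖P‖ * 2 := fun n => P.le_opNorm_of_le (he n)
  -- the shift by `1` gives nonnegative times as long as `-(2 * π) ≤ v.im`
  let τ : ℂ → ℝ := fun v => v.im / (2 * π) + 1
  have hτ : ∀ p : ℕ∞, ContDiff ℝ p τ := fun p =>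
    (imCLM.contDiff.div_const _).add contDiff_const
  have hτl : LipschitzWith (1 / (2 * π)).toNNReal τ := by
    refine LipschitzWith.of_dist_le_mul fun v v' => ?_
    rw [Real.coe_toNNReal _ (by positivity), Real.dist_eq, Complex.dist_eq]
    have h1 : τ v - τ v' = 1 / (2 * π) * (v - v').im := by
      simp only [τ, sub_im]; ring
    rw [h1, abs_mul, abs_of_nonneg (by positivity)]
    gcongr
    exact abs_im_le_norm _
  obtain ⟨K, hK⟩ := exists_lipschitzWith_vertexPath he'
  have hsep : ∀ v v' : ℂ, ∀ k : ℤ, -(2 * π) ≤ v.im → 0 < k → v' = v + k * (2 * π * I) →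
      1 / (2 + 2 * (‖P‖ * 2)) ≤ ‖vertexPath e' (τ v') - vertexPath e' (τ v)‖ := by
    rintro v v' k hv hk rfl
    lift k to ℕ using hk.le
    have h0 : 0 ≤ τ v := by
      have := (le_div_iff₀ Real.two_pi_pos).2 ((neg_one_mul (2 * π)).trans_le hv)
      simp only [τ]
      linarith
    have h1 : τ (v + (k : ℤ) * (2 * π * I)) = τ v + k := by
      simp [τ]
      field_simp
      ring
    rw [h1]
    refine le_norm_vertexPath_sub he' (fun n => ?_) hg (fun m n hmn => ?_) h0
      (by exact_mod_cast hk)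
    · rw [hge', hge]
    · rw [hge', htri m n hmn]
  refine ⟨fun v => vertexPath e' (τ v), fun v => ?_,
    fun p => (contDiff_vertexPath e').comp (hτ p), ⟨_, fun v => norm_vertexPath_le he' _⟩,
    ⟨_, hK.comp hτl⟩, 1 / (2 + 2 * (‖P‖ * 2)) / 4, by positivity,
    fun v v' hvv hv hv' hne => ?_⟩
  · simp only [vertexPath, e', map_add, map_smul, map_sub, hζP, sub_zero, smul_zero, add_zero]
  · rw [mul_div_cancel₀ _ four_ne_zero]
    obtain ⟨k, hk⟩ := exp_eq_exp_iff_exists_int.1 hvv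
    rcases lt_trichotomy k 0 with h | h | h
    · rw [norm_sub_rev (vertexPath e' (τ v))]
      refine hsep v v' (-k) hv (neg_pos.2 h) ?_
      rw [hk]
      push_cast
      ring
    · rw [h] at hk
      simp at hk
      exact absurd hk hne
    · exact hsep v' v k hv' h hk

/-! ### The helical tube and its function -/

/-- The data defining a helical tube in `X`: a complex coordinate `ζ` with right inverse `j`, so
that `X` is the sum of `range j` and `ker ζ`; a path `W` in `ker ζ`, parametrized by (the imaginary
part of) a logarithm of `ζ`, whose values at different logarithms of the same number are `4 * r`
apart; and a bump function `φ` supported in the ball of radius `r` with star-shaped nonvanishing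
set. -/
structure HelicalTube (X : Type*) [NormedAddCommGroup X] [NormedSpace ℝ X] (p : ℕ∞) where
  ζ : X →L[ℝ] ℂ
  j : ℂ →L[ℝ] X
  ζ_j : ∀ c, ζ (j c) = c
  W : ℂ → X
  ζ_W : ∀ v, ζ (W v) = 0
  contDiff_W : ContDiff ℝ p W
  norm_W_le : ∃ M, ∀ v, ‖W v‖ ≤ M
  lipschitzWith_W : ∃ K, LipschitzWith K W
  r : ℝ
  r_pos : 0 < r
  sep : ∀ v v' : ℂ, Complex.exp v = Complex.exp v' → -(2 * Real.pi) ≤ v.im →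
    -(2 * Real.pi) ≤ v'.im → v ≠ v' → 4 * r ≤ ‖W v - W v'‖
  φ : X → ℝ
  contDiff_φ : ContDiff ℝ p φ
  φ_mem : ∀ x, φ x ∈ Icc (0 : ℝ) 1
  φ_zero : φ 0 ≠ 0
  norm_lt_of_φ : ∀ x, φ x ≠ 0 → ‖x‖ < r
  φ_star : ∀ x, φ x ≠ 0 → ∀ s : ℝ, 0 < s → s ≤ 1 → φ (s • x) ≠ 0

namespace HelicalTube

variable {p : ℕ∞} (T : HelicalTube X p)

/-- The projection onto `ker ζ` along `range j`. -/
noncomputable def proj : X →L[ℝ] X := ContinuousLinearMap.id ℝ X - T.j.comp T.ζ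

theorem proj_apply (x : X) : T.proj x = x - T.j (T.ζ x) := rfl

/-- The tube function in the coordinates `(v, k)`, where `v` is a logarithm of `ζ` and `k` is the
component in `ker ζ`. It increases with `v.im` where it does not vanish and `k - W v` is fixed. -/
noncomputable def profile (v : ℂ) (k : X) : ℝ :=
  intervalCutoff v.re * expNegInvGlue v.im * T.φ (k - T.W v)

theorem profile_ne_zero_iff {v : ℂ} {k : X} :
    T.profile v k ≠ 0 ↔ |v.re| < 1 ∧ 0 < v.im ∧ T.φ (k - T.W v) ≠ 0 := by
  have h : expNegInvGlue v.im ≠ 0 ↔ 0 < v.im := by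
    rw [Ne, expNegInvGlue.zero_iff_nonpos, not_le]
  rw [profile, mul_ne_zero_iff, mul_ne_zero_iff, intervalCutoff_ne_zero_iff, h, and_assoc]

theorem cutoffs_mem_Icc (v : ℂ) : intervalCutoff v.re * expNegInvGlue v.im ∈ Icc (0 : ℝ) 1 :=
  have h := intervalCutoff_mem_Icc v.re
  have h' := expNegInvGlue.mem_Icc v.im
  ⟨mul_nonneg h.1 h'.1, mul_le_one₀ h.2 h'.1 h'.2⟩

theorem profile_mem_Icc (v : ℂ) (k : X) : T.profile v k ∈ Icc (0 : ℝ) 1 :=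
  have h := cutoffs_mem_Icc v
  have h' := T.φ_mem (k - T.W v)
  ⟨mul_nonneg h.1 h'.1, mul_le_one₀ h.2 h'.1 h'.2⟩

theorem contDiff_profile : ContDiff ℝ p fun q : ℂ × X => T.profile q.1 q.2 :=
  ((contDiff_intervalCutoff.comp (Complex.reCLM.contDiff.comp contDiff_fst)).mul
    (expNegInvGlue.contDiff.comp (Complex.imCLM.contDiff.comp contDiff_fst))).mul
    (T.contDiff_φ.comp (contDiff_snd.sub (T.contDiff_W.comp contDiff_fst)))

theorem exists_lipschitzWith_profile (h : ∃ K, LipschitzWith K T.φ) :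
    ∃ K, LipschitzWith K fun q : ℂ × X => T.profile q.1 q.2 := by
  obtain ⟨K, hK⟩ := h
  obtain ⟨L, hL⟩ := exists_lipschitzWith_intervalCutoff
  obtain ⟨N, hN⟩ := T.lipschitzWith_W
  have hre : LipschitzWith 1 fun q : ℂ × X => q.1.re := LipschitzWith.of_dist_le_mul fun q q' => by
    rw [NNReal.coe_one, one_mul, Real.dist_eq, ← Complex.sub_re]
    exact (Complex.abs_re_le_norm _).trans ((dist_eq_norm q.1 q'.1).ge.trans (le_max_left _ _))
  have him : LipschitzWith 1 fun q : ℂ × X => q.1.im := LipschitzWith.of_dist_le_mul fun q q' => by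
    rw [NNReal.coe_one, one_mul, Real.dist_eq, ← Complex.sub_im]
    exact (Complex.abs_im_le_norm _).trans ((dist_eq_norm q.1 q'.1).ge.trans (le_max_left _ _))
  exact ⟨_, (((hL.comp hre).mul_of_mem_Icc (expNegInvGlue.lipschitzWith.comp him)
    (fun _ => intervalCutoff_mem_Icc _) fun _ => expNegInvGlue.mem_Icc _).mul_of_mem_Icc
    (hK.comp (LipschitzWith.prod_snd.sub (hN.comp LipschitzWith.prod_fst)))
    (fun _ => cutoffs_mem_Icc _) fun _ => T.φ_mem _)⟩

theorem exp_neg_one_lt_norm_exp {v : ℂ} (hv : |v.re| < 1) :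
    Real.exp (-1) < ‖Complex.exp v‖ ∧ ‖Complex.exp v‖ < Real.exp 1 := by
  rw [Complex.norm_exp, Real.exp_lt_exp, Real.exp_lt_exp]
  exact abs_lt.1 hv

theorem eq_of_profile_ne_zero {v v' : ℂ} {k : X} (hvv : Complex.exp v = Complex.exp v')
    (hv : T.profile v k ≠ 0) (hv' : T.profile v' k ≠ 0) : v = v' := by
  rw [profile_ne_zero_iff] at hv hv'
  by_contra hne
  have h1 := T.sep v v' hvv (by linarith [Real.pi_pos]) (by linarith [Real.pi_pos]) hne
  have h2 := T.norm_lt_of_φ _ hv.2.2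
  have h3 := T.norm_lt_of_φ _ hv'.2.2
  have h4 : T.W v - T.W v' = (k - T.W v') - (k - T.W v) := by abel
  have h5 := norm_sub_le (k - T.W v') (k - T.W v)
  rw [← h4] at h5
  linarith [T.r_pos]

open Classical in
/-- The logarithm of `ζ x` which is the helical coordinate of `x`, for `x` in the tube. Outside the
tube it is `-2`, a value at which the profile vanishes. -/
noncomputable def log (x : X) : ℂ :=
  if h : ∃ v, Complex.exp v = T.ζ x ∧ T.profile v (T.proj x) ≠ 0 then h.choose else -2

/-- The tube function: the profile at the helical coordinate, and `0` outside the tube. -/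
noncomputable def toFun (x : X) : ℝ := T.profile (T.log x) (T.proj x)

theorem toFun_mem_Icc (x : X) : T.toFun x ∈ Icc (0 : ℝ) 1 := T.profile_mem_Icc _ _

theorem log_eq {x : X} {v : ℂ} (hv : Complex.exp v = T.ζ x)
    (hv' : T.profile v (T.proj x) ≠ 0) : T.log x = v := by
  have h : ∃ v, Complex.exp v = T.ζ x ∧ T.profile v (T.proj x) ≠ 0 := ⟨v, hv, hv'⟩
  rw [log, dif_pos h]
  exact T.eq_of_profile_ne_zero (h.choose_spec.1.trans hv.symm) h.choose_spec.2 hv'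

theorem exp_log {x : X} (hx : T.toFun x ≠ 0) : Complex.exp (T.log x) = T.ζ x := by
  by_cases h : ∃ v, Complex.exp v = T.ζ x ∧ T.profile v (T.proj x) ≠ 0
  · rw [log, dif_pos h]
    exact h.choose_spec.1
  · rw [toFun, log, dif_neg h, profile_ne_zero_iff] at hx
    norm_num at hx

/-- The branch of the logarithm of `ζ` near `x₀` with value `u₀` at `x₀`. -/
noncomputable def branch (x₀ : X) (u₀ : ℂ) (x : X) : ℂ := Complex.log (T.ζ x / T.ζ x₀) + u₀

theorem branch_self {x₀ : X} (h : T.ζ x₀ ≠ 0) (u₀ : ℂ) : T.branch x₀ u₀ x₀ = u₀ := by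
  rw [branch, div_self h, Complex.log_one, zero_add]

theorem contDiffAt_branch {x₀ : X} (h : T.ζ x₀ ≠ 0) (u₀ : ℂ) {n : WithTop ℕ∞} :
    ContDiffAt ℝ n (T.branch x₀ u₀) x₀ := by
  have h1 : ContDiffAt ℝ n Complex.log (T.ζ x₀ / T.ζ x₀) := by
    rw [div_self h]
    exact (Complex.contDiffAt_log Complex.one_mem_slitPlane).restrict_scalars ℝ
  exact (h1.comp x₀ (T.ζ.contDiff.contDiffAt.div_const _)).add contDiffAt_const

theorem norm_fderiv_branch_le {x₀ : X} (h : T.ζ x₀ ≠ 0) (u₀ : ℂ) :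
    ‖fderiv ℝ (T.branch x₀ u₀) x₀‖ ≤ ‖T.ζ x₀‖⁻¹ * ‖T.ζ‖ := by
  have h1 : HasDerivAt (fun z => Complex.log (z / T.ζ x₀) + u₀) (1 / T.ζ x₀) (T.ζ x₀) := by
    have h2 := ((hasDerivAt_id (T.ζ x₀)).div_const (T.ζ x₀)).clog
      (by rw [id, div_self h]; exact Complex.one_mem_slitPlane)
    simpa [div_self h] using h2.add_const u₀
  have h2 := (h1.hasFDerivAt.restrictScalars ℝ).comp x₀ T.ζ.hasFDerivAt
  have h3 : T.branch x₀ u₀ = (fun z => Complex.log (z / T.ζ x₀) + u₀) ∘ T.ζ := rfl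
  rw [h3, h2.fderiv]
  refine (ContinuousLinearMap.opNorm_comp_le _ _).trans ?_
  gcongr
  rw [ContinuousLinearMap.norm_restrictScalars]
  simp

/-- Near a point where `ζ` does not vanish, one fixed branch of the logarithm gives the helical
coordinate of all points of the tube. At most one logarithm `u₀` of `ζ x₀` with
`-(2 * π) ≤ u₀.im` satisfies `‖proj x₀ - W u₀‖ < 2 * r`, and the branches through the other
logarithms stay away from the tube near `x₀`. -/
theorem exists_branch {x₀ : X} (h : T.ζ x₀ ≠ 0) : ∃ u₀ : ℂ, Complex.exp u₀ = T.ζ x₀ ∧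
    ∀ᶠ x in 𝓝 x₀, Complex.exp (T.branch x₀ u₀ x) = T.ζ x ∧
      ∀ v, Complex.exp v = T.ζ x → T.profile v (T.proj x) ≠ 0 → v = T.branch x₀ u₀ x := by
  have hr := T.r_pos
  obtain ⟨N, hN⟩ := T.lipschitzWith_W
  let C : Set ℂ := {v | Complex.exp v = T.ζ x₀ ∧ -(2 * Real.pi) ≤ v.im ∧
    ‖T.proj x₀ - T.W v‖ < 2 * T.r}
  obtain ⟨u₀, hu₀, huC⟩ : ∃ u₀, Complex.exp u₀ = T.ζ x₀ ∧ ∀ v ∈ C, v = u₀ := by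
    rcases C.eq_empty_or_nonempty with hC | ⟨u, hu⟩
    · exact ⟨Complex.log (T.ζ x₀), Complex.exp_log h, fun v hv => by simp [hC] at hv⟩
    · refine ⟨u, hu.1, fun v hv => ?_⟩
      by_contra hne
      have h1 := T.sep v u (hv.1.trans hu.1.symm) hv.2.1 hu.2.1 hne
      have h2 : T.W v - T.W u = (T.proj x₀ - T.W u) - (T.proj x₀ - T.W v) := by abel
      have h3 := norm_sub_le (T.proj x₀ - T.W u) (T.proj x₀ - T.W v)
      rw [← h2] at h3
      linarith [hu.2.2, hv.2.2]
  refine ⟨u₀, hu₀, ?_⟩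
  have hcont : Tendsto (T.branch x₀ u₀) (𝓝 x₀) (𝓝 u₀) := by
    have := (T.contDiffAt_branch h u₀ (n := 0)).continuousAt
    rwa [ContinuousAt, T.branch_self h] at this
  have e1 : ∀ᶠ x in 𝓝 x₀, T.ζ x ≠ 0 := T.ζ.continuous.continuousAt.eventually_ne h
  have e2 : ∀ᶠ x in 𝓝 x₀, ‖T.branch x₀ u₀ x - u₀‖ < 1 :=
    (Metric.tendsto_nhds.1 hcont 1 one_pos).mono fun x hx => by rwa [dist_eq_norm] at hx
  have e3 : ∀ᶠ x in 𝓝 x₀, N * ‖T.branch x₀ u₀ x - u₀‖ < T.r / 2 := by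
    have h1 : Tendsto (fun x => N * ‖T.branch x₀ u₀ x - u₀‖) (𝓝 x₀) (𝓝 (N * ‖u₀ - u₀‖)) :=
      ((hcont.sub_const u₀).norm).const_mul _
    exact h1.eventually (gt_mem_nhds (by simpa using hr))
  have e4 : ∀ᶠ x in 𝓝 x₀, ‖T.proj x - T.proj x₀‖ < T.r / 2 :=
    (Metric.tendsto_nhds.1 T.proj.continuous.continuousAt _ (half_pos hr)).mono
      fun x hx => by rwa [dist_eq_norm] at hx
  filter_upwards [e1, e2, e3, e4] with x h1 h2 h3 h4
  have hb : Complex.exp (T.branch x₀ u₀ x) = T.ζ x := by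
    rw [branch, Complex.exp_add, Complex.exp_log (div_ne_zero h1 h), hu₀, div_mul_cancel₀ _ h]
  refine ⟨hb, fun v hv hv' => ?_⟩
  rw [profile_ne_zero_iff] at hv'
  set b := T.branch x₀ u₀ x
  -- the logarithm of `ζ x₀` continuing `v`
  have hC : v - (b - u₀) ∈ C := by
    refine ⟨?_, ?_, ?_⟩
    · rw [Complex.exp_sub, Complex.exp_sub, hv, hb, hu₀, div_div_cancel₀ h1]
    · have := (Complex.abs_im_le_norm (b - u₀)).trans_lt h2
      rw [Complex.sub_im]
      linarith [hv'.2.1, (abs_lt.1 this).2, Real.pi_gt_three]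
    · have h5 := T.norm_lt_of_φ _ hv'.2.2
      have h6 := hN.dist_le_mul v (v - (b - u₀))
      rw [dist_eq_norm, dist_eq_norm, sub_sub_cancel] at h6
      have h7 : T.proj x₀ - T.W (v - (b - u₀)) =
          (T.proj x - T.W v) - (T.proj x - T.proj x₀) + (T.W v - T.W (v - (b - u₀))) := by abel
      rw [h7]
      have h8 := norm_add_le ((T.proj x - T.W v) - (T.proj x - T.proj x₀))
        (T.W v - T.W (v - (b - u₀)))
      have h9 := norm_sub_le (T.proj x - T.W v) (T.proj x - T.proj x₀)
      linarith
  have := huC _ hC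
  linear_combination this

theorem exists_branch_eventuallyEq {x₀ : X} (h : T.ζ x₀ ≠ 0) : ∃ u₀ : ℂ,
    Complex.exp u₀ = T.ζ x₀ ∧
    (T.toFun =ᶠ[𝓝 x₀] fun x => T.profile (T.branch x₀ u₀ x) (T.proj x)) ∧
    ∀ᶠ x in 𝓝 x₀, T.toFun x ≠ 0 → T.log x = T.branch x₀ u₀ x := by
  obtain ⟨u₀, hu₀, hev⟩ := T.exists_branch h
  refine ⟨u₀, hu₀, ?_, ?_⟩
  · filter_upwards [hev] with x hx
    by_cases h0 : T.profile (T.branch x₀ u₀ x) (T.proj x) = 0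
    · rw [h0]
      by_contra h1
      have h2 := hx.2 _ (T.exp_log h1) h1
      exact h1 (by rw [toFun, h2, h0])
    · rw [toFun, T.log_eq hx.1 h0]
  · filter_upwards [hev] with x hx h0 using hx.2 _ (T.exp_log h0) h0

theorem exp_neg_one_lt_norm {x : X} (hx : T.toFun x ≠ 0) : Real.exp (-1) < ‖T.ζ x‖ := by
  rw [← T.exp_log hx]
  exact (exp_neg_one_lt_norm_exp (T.profile_ne_zero_iff.1 hx).1).1

theorem ζ_ne_zero {x : X} (hx : T.toFun x ≠ 0) : T.ζ x ≠ 0 :=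
  norm_pos_iff.1 ((Real.exp_pos _).trans (T.exp_neg_one_lt_norm hx))

theorem contDiff_toFun : ContDiff ℝ p T.toFun := by
  rw [contDiff_iff_contDiffAt]
  intro x₀
  by_cases h : T.ζ x₀ = 0
  · have h1 : ∀ᶠ x in 𝓝 x₀, ‖T.ζ x‖ < Real.exp (-1) := by
      refine T.ζ.continuous.norm.continuousAt.eventually (gt_mem_nhds ?_)
      beta_reduce
      rw [h, norm_zero]
      exact Real.exp_pos _
    refine (contDiffAt_const (c := (0 : ℝ))).congr_of_eventuallyEq ?_
    filter_upwards [h1] with x hx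
    by_contra h2
    exact (T.exp_neg_one_lt_norm h2).not_gt hx
  · obtain ⟨u₀, -, hu, -⟩ := T.exists_branch_eventuallyEq h
    refine ContDiffAt.congr_of_eventuallyEq ?_ hu
    exact ContDiffAt.comp (g := fun q : ℂ × X => T.profile q.1 q.2)
      (f := fun x => (T.branch x₀ u₀ x, T.proj x)) x₀ T.contDiff_profile.contDiffAt
      ((T.contDiffAt_branch h u₀).prodMk T.proj.contDiff.contDiffAt)

theorem exists_lipschitzWith_toFun (hp : 1 ≤ p) (hφ : ∃ K, LipschitzWith K T.φ) :
    ∃ K, LipschitzWith K T.toFun := by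
  have hp' : (p : WithTop ℕ∞) ≠ 0 := by
    have := zero_lt_one.trans_le hp
    exact_mod_cast this.ne'
  obtain ⟨K, hK⟩ := T.exists_lipschitzWith_profile hφ
  let A : ℝ := Real.exp 1 * ‖T.ζ‖ + ‖T.proj‖
  have hA : 0 ≤ A := by positivity
  refine ⟨K * A.toNNReal, lipschitzWith_of_nnnorm_fderiv_le (𝕜 := ℝ)
    (T.contDiff_toFun.differentiable hp') fun x₀ => ?_⟩
  rw [← NNReal.coe_le_coe, NNReal.coe_mul, Real.coe_toNNReal _ hA, coe_nnnorm]
  by_cases h0 : T.toFun x₀ = 0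
  · have hmin : IsLocalMin T.toFun x₀ :=
      Eventually.of_forall fun x => h0.le.trans (T.toFun_mem_Icc x).1
    rw [hmin.fderiv_eq_zero, norm_zero]
    positivity
  · have h := T.ζ_ne_zero h0
    obtain ⟨u₀, -, hu, -⟩ := T.exists_branch_eventuallyEq h
    have hb := ((T.contDiffAt_branch h u₀ (n := 1)).differentiableAt one_ne_zero).hasFDerivAt
    have hF := (T.contDiff_profile.differentiable hp' (T.branch x₀ u₀ x₀, T.proj x₀)).hasFDerivAt
    have hcomp := hF.comp x₀ (hb.prodMk T.proj.hasFDerivAt)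
    rw [hu.fderiv_eq]
    have : fderiv ℝ (fun x => T.profile (T.branch x₀ u₀ x) (T.proj x)) x₀ = _ := hcomp.fderiv
    rw [this]
    refine (ContinuousLinearMap.opNorm_comp_le _ _).trans
      (mul_le_mul (norm_fderiv_le_of_lipschitz ℝ hK) ?_ (norm_nonneg _) K.coe_nonneg)
    refine ContinuousLinearMap.opNorm_le_bound _ hA fun y => ?_
    have hinv : ‖T.ζ x₀‖⁻¹ ≤ Real.exp 1 := by
      rw [← inv_inv (Real.exp 1), ← Real.exp_neg]
      exact inv_anti₀ (Real.exp_pos _) (T.exp_neg_one_lt_norm h0).le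
    have h1 : ‖fderiv ℝ (T.branch x₀ u₀) x₀‖ ≤ Real.exp 1 * ‖T.ζ‖ :=
      (T.norm_fderiv_branch_le h u₀).trans (by gcongr)
    refine max_le ?_ ?_
    · refine (ContinuousLinearMap.le_of_opNorm_le _ h1 y).trans ?_
      gcongr
      exact le_add_of_nonneg_right (norm_nonneg _)
    · refine (T.proj.le_opNorm y).trans ?_
      gcongr
      exact le_add_of_nonneg_left (by positivity)

/-- The point of the tube with helical coordinate `q.1` and offset `q.2` from the axis. -/
noncomputable def point (q : ℂ × X) : X := T.j (Complex.exp q.1) + T.W q.1 + q.2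

/-- The domain of the coordinates `(v, h)` on the tube. -/
def coordDomain : Set (ℂ × X) :=
  {q | |q.1.re| < 1 ∧ 0 < q.1.im ∧ T.ζ q.2 = 0 ∧ T.φ q.2 ≠ 0}

theorem continuous_point : Continuous T.point :=
  ((T.j.continuous.comp (Complex.continuous_exp.comp continuous_fst)).add
    (T.contDiff_W.continuous.comp continuous_fst)).add continuous_snd

theorem ζ_point {q : ℂ × X} (hq : T.ζ q.2 = 0) : T.ζ (T.point q) = Complex.exp q.1 := by
  rw [point, map_add, map_add, T.ζ_j, T.ζ_W, hq, add_zero, add_zero]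

theorem proj_point {q : ℂ × X} (hq : T.ζ q.2 = 0) : T.proj (T.point q) = T.W q.1 + q.2 := by
  rw [proj_apply, T.ζ_point hq, point]
  abel

theorem log_point {q : ℂ × X} (hq : q ∈ T.coordDomain) : T.log (T.point q) = q.1 := by
  refine T.log_eq (T.ζ_point hq.2.2.1).symm ?_
  rw [T.proj_point hq.2.2.1, profile_ne_zero_iff, add_sub_cancel_left]
  exact ⟨hq.1, hq.2.1, hq.2.2.2⟩

theorem toFun_point {q : ℂ × X} (hq : q ∈ T.coordDomain) :
    T.toFun (T.point q) = intervalCutoff q.1.re * expNegInvGlue q.1.im * T.φ q.2 := by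
  rw [toFun, T.log_point hq, T.proj_point hq.2.2.1, profile, add_sub_cancel_left]

/-- The coordinates of a point of the tube. -/
noncomputable def coord (x : X) : ℂ × X := (T.log x, T.proj x - T.W (T.log x))

theorem coord_mem {x : X} (hx : T.toFun x ≠ 0) : T.coord x ∈ T.coordDomain := by
  have h := T.profile_ne_zero_iff.1 hx
  refine ⟨h.1, h.2.1, ?_, h.2.2⟩
  simp only [coord]
  rw [map_sub, T.ζ_W, proj_apply, map_sub, T.ζ_j, sub_self, sub_zero]

theorem point_coord {x : X} (hx : T.toFun x ≠ 0) : T.point (T.coord x) = x := by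
  simp only [point, coord]
  rw [T.exp_log hx, proj_apply]
  abel

theorem coord_point {q : ℂ × X} (hq : q ∈ T.coordDomain) : T.coord (T.point q) = q := by
  rw [coord, T.log_point hq, T.proj_point hq.2.2.1, add_sub_cancel_left]

theorem toFun_point_ne_zero {q : ℂ × X} (hq : q ∈ T.coordDomain) : T.toFun (T.point q) ≠ 0 := by
  rw [toFun, T.log_point hq, T.proj_point hq.2.2.1, profile_ne_zero_iff, add_sub_cancel_left]
  exact ⟨hq.1, hq.2.1, hq.2.2.2⟩

theorem continuousOn_log : ContinuousOn T.log {x | T.toFun x ≠ 0} := by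
  intro x₀ hx₀
  have h := T.ζ_ne_zero hx₀
  obtain ⟨u₀, -, -, hu⟩ := T.exists_branch_eventuallyEq h
  refine (T.contDiffAt_branch h u₀ (n := 0)).continuousAt.continuousWithinAt.congr_of_eventuallyEq
    ?_ (hu.self_of_nhds hx₀)
  filter_upwards [mem_nhdsWithin_of_mem_nhds hu, self_mem_nhdsWithin] with x hx hx' using hx hx'

theorem continuousOn_coord : ContinuousOn T.coord {x | T.toFun x ≠ 0} :=
  T.continuousOn_log.prodMk (T.proj.continuous.continuousOn.sub
    (T.contDiff_W.continuous.comp_continuousOn T.continuousOn_log))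

/-- The tube is homeomorphic to its coordinate domain. -/
noncomputable def homeomorph : {x | T.toFun x ≠ 0} ≃ₜ T.coordDomain where
  toFun x := ⟨T.coord x, T.coord_mem x.2⟩
  invFun q := ⟨T.point q, T.toFun_point_ne_zero q.2⟩
  left_inv x := Subtype.ext (T.point_coord x.2)
  right_inv q := Subtype.ext (T.coord_point q.2)
  continuous_toFun := T.continuousOn_coord.domRestrict.subtype_mk _
  continuous_invFun := (T.continuous_point.comp continuous_subtype_val).subtype_mk _

theorem contractibleSpace : ContractibleSpace {x | T.toFun x ≠ 0} := by
  have hmem : (Complex.I, (0 : X)) ∈ T.coordDomain := by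
    refine ⟨by simp, by simp, map_zero _, T.φ_zero⟩
  have hstar : StarConvex ℝ (Complex.I, (0 : X)) T.coordDomain := by
    rw [starConvex_iff_forall_pos hmem]
    rintro ⟨v, h⟩ ⟨h1, h2, h3, h4⟩ a b ha hb hab
    refine ⟨?_, ?_, ?_, ?_⟩
    · simp only [Prod.smul_mk, Prod.mk_add_mk, Complex.add_re, Complex.smul_re, Complex.I_re,
        smul_eq_mul, mul_zero, zero_add]
      rw [abs_mul, abs_of_pos hb]
      nlinarith [abs_nonneg v.re]
    · simp only [Prod.smul_mk, Prod.mk_add_mk, Complex.add_im, Complex.smul_im, Complex.I_im,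
        smul_eq_mul, mul_one]
      have : 0 < b * v.im := mul_pos hb h2
      linarith
    · simp only [Prod.smul_mk, Prod.mk_add_mk, smul_zero, zero_add]
      rw [map_smul, h3, smul_zero]
    · simp only [Prod.smul_mk, Prod.mk_add_mk, smul_zero, zero_add]
      exact T.φ_star h h4 b hb (by linarith)
  have := hstar.contractibleSpace ⟨_, hmem⟩
  exact T.homeomorph.contractibleSpace

theorem isBounded_tube : Bornology.IsBounded {x | T.toFun x ≠ 0} := by
  obtain ⟨M, hM⟩ := T.norm_W_le
  refine (Metric.isBounded_closedBall (x := (0 : X)) (r := ‖T.j‖ * Real.exp 1 + M + T.r)).subset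
    fun x hx => ?_
  rw [mem_closedBall_zero_iff]
  have h := T.coord_mem hx
  rw [← T.point_coord hx, point]
  refine (norm_add₃_le ..).trans (add_le_add (add_le_add ?_ (hM _)) ?_)
  · exact T.j.le_opNorm_of_le (exp_neg_one_lt_norm_exp h.1).2.le
  · exact (T.norm_lt_of_φ _ h.2.2.2).le

/-- Along the helix through a point of the tube, `toFun` is a positive multiple of
`expNegInvGlue`, which has positive derivative. -/
theorem fderiv_toFun_ne_zero (hp : 1 ≤ p) {x : X} (hx : T.toFun x ≠ 0) :
    fderiv ℝ T.toFun x ≠ 0 := by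
  intro h0
  have hp' : (p : WithTop ℕ∞) ≠ 0 := by
    have := zero_lt_one.trans_le hp
    exact_mod_cast this.ne'
  obtain ⟨h1, h2, h3, h4⟩ := T.coord_mem hx
  have hxc := T.point_coord hx
  set v := (T.coord x).1
  set h := (T.coord x).2
  let γ : ℝ → ℂ := fun s => v + s * Complex.I
  have hγ0 : γ 0 = v := by simp [γ]
  have hγim : ∀ s, (γ s).im = v.im + s := fun s => by simp [γ]
  have hγre : ∀ s, (γ s).re = v.re := fun s => by simp [γ]
  have hγ : DifferentiableAt ℝ γ 0 :=
    (Complex.ofRealCLM.differentiableAt.mul_const _).const_add _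
  have hc : DifferentiableAt ℝ (fun s => T.point (γ s, h)) 0 := by
    refine DifferentiableAt.add_const _ (DifferentiableAt.add ?_ ?_)
    · refine T.j.differentiableAt.comp _ ?_
      exact hγ.cexp
    · exact (T.contDiff_W.differentiable hp' _).comp _ hγ
  have hpt : T.point (γ 0, h) = x := by rw [hγ0]; exact hxc
  have hf : HasFDerivAt T.toFun (0 : X →L[ℝ] ℝ) (T.point (γ 0, h)) := by
    rw [hpt, ← h0]
    exact (T.contDiff_toFun.differentiable hp' x).hasFDerivAt
  have hd1 : HasDerivAt (fun s => T.toFun (T.point (γ s, h))) 0 0 := by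
    have := hf.comp_hasDerivAt (0 : ℝ) hc.hasDerivAt
    rwa [zero_apply] at this
  have hd2 : HasDerivAt (fun s => intervalCutoff v.re * expNegInvGlue (v.im + s) * T.φ h)
      (intervalCutoff v.re * ((v.im + 0)⁻¹ ^ 2 * expNegInvGlue (v.im + 0)) * T.φ h) 0 :=
    (((expNegInvGlue.hasDerivAt (v.im + 0)).comp_const_add v.im 0).const_mul _).mul_const _
  have hev : (fun s => T.toFun (T.point (γ s, h))) =ᶠ[𝓝 0]
      fun s => intervalCutoff v.re * expNegInvGlue (v.im + s) * T.φ h := by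
    filter_upwards [lt_mem_nhds (neg_lt_zero.2 h2)] with s hs
    have hmem : (γ s, h) ∈ T.coordDomain :=
      ⟨by rwa [hγre], by rw [hγim]; linarith, h3, h4⟩
    rw [T.toFun_point hmem]
    simp only [hγre, hγim]
  have := hd1.unique (hd2.congr_of_eventuallyEq hev)
  rw [add_zero] at this
  have h5 := expNegInvGlue.pos_of_pos h2
  have h6 := inv_pos.2 h2
  exact mul_ne_zero (mul_ne_zero (intervalCutoff_ne_zero_iff.2 h1) (by positivity)) h4 this.symm

end HelicalTube

/-- A bump function on an infinite-dimensional space yields a helical tube. -/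
theorem IsBump.exists_helicalTube (hX : ¬ FiniteDimensional ℝ X) {b : X → ℝ} (hb : IsBump b)
    {p : ℕ∞} (hbp : ContDiff ℝ p b) :
    ∃ T : HelicalTube X p, (∃ K, LipschitzWith K b) → ∃ K, LipschitzWith K T.φ := by
  obtain ⟨ζ, j, hζj⟩ := exists_complex_coordinate hX
  obtain ⟨W, hζW, hW, hM, hK, r, hr, hsep⟩ := exists_separated_path hX hζj
  obtain ⟨φ, hφ, hφ01, hφ0, hφr, hφs, hφl⟩ := hb.exists_starShaped hbp hr
  exact ⟨⟨ζ, j, hζj, W, hζW, hW p, hM, hK, r, hr, hsep, φ, hφ, hφ01, hφ0, hφr, hφs⟩, hφl⟩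

/-! ### Extension by zero across the frontier -/

section Extension

variable {U : Set X} {f : X → ℝ}

/-- If `f` vanishes on the frontier of the open set `U`, then it is small on `U` near the points
outside `U`. -/
theorem eventually_lt_of_frontier {E : Type*} [TopologicalSpace E] {U : Set E} {f : E → ℝ}
    (hU : IsOpen U) (hf : ContinuousOn f (closure U))
    (hf0 : ∀ x ∈ frontier U, f x = 0) {x : E} (hx : x ∉ U) {ε : ℝ} (hε : 0 < ε) :
    ∀ᶠ y in 𝓝 x, y ∈ U → |f y| < ε := by
  by_cases hxc : x ∈ closure U
  · have h0 : f x = 0 := hf0 x (hU.frontier_eq ▸ ⟨hxc, hx⟩)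
    have h1 : Tendsto (fun y => |f y|) (𝓝[closure U] x) (𝓝 |f x|) := (hf x hxc).abs
    rw [h0, abs_zero] at h1
    filter_upwards [eventually_nhdsWithin_iff.1 (h1.eventually (gt_mem_nhds hε))] with y hy hyU
      using hy (subset_closure hyU)
  · filter_upwards [isClosed_closure.isOpen_compl.mem_nhds hxc] with y hy hyU
      using absurd (subset_closure hyU) hy

/-- A Lipschitz function on `U`, vanishing on the frontier, stays Lipschitz when extended by zero:
a segment leaving `U` crosses the frontier. -/
theorem lipschitzWith_indicator_of_frontier (hU : IsOpen U) (hf : ContinuousOn f (closure U))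
    (hf0 : ∀ x ∈ frontier U, f x = 0) {K : ℝ≥0} (hK : LipschitzOnWith K f U) :
    LipschitzWith K (U.indicator f) := by
  have hKc : LipschitzOnWith K f (closure U) := hK.closure hf
  have key : ∀ x ∈ U, ∀ y ∉ U, |f x| ≤ K * dist x y := by
    intro x hx y hy
    obtain ⟨z, hz, hzU⟩ : ∃ z ∈ segment ℝ x y, z ∈ frontier U := by
      by_contra! h
      refine hy ((convex_segment x y).isPreconnected.subset_of_closure_inter_subset hU
        ⟨x, left_mem_segment ℝ x y, hx⟩ (fun z hz => ?_) (right_mem_segment ℝ x y))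
      by_contra hzU
      exact h z hz.2 (hU.frontier_eq ▸ ⟨hz.1, hzU⟩)
    have h1 := hKc.dist_le_mul x (subset_closure hx) z (frontier_subset_closure hzU)
    rw [hf0 z hzU, Real.dist_eq, sub_zero] at h1
    have h2 : dist x z ≤ dist x y := by
      have := dist_add_dist_of_mem_segment hz
      linarith [dist_nonneg (x := z) (y := y)]
    exact h1.trans (by gcongr)
  refine LipschitzWith.of_dist_le_mul fun x y => ?_
  by_cases hx : x ∈ U <;> by_cases hy : y ∈ U
  · rw [indicator_of_mem hx, indicator_of_mem hy]
    exact hK.dist_le_mul x hx y hy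
  · rw [indicator_of_mem hx, indicator_of_notMem hy, Real.dist_eq, sub_zero]
    exact key x hx y hy
  · rw [indicator_of_notMem hx, indicator_of_mem hy, Real.dist_eq, zero_sub, abs_neg, dist_comm x]
    exact key y hy x hx
  · rw [indicator_of_notMem hx, indicator_of_notMem hy, dist_self]
    positivity

/-- A function on a bounded nonempty open set with zero frontier values and nonvanishing derivative
becomes a bump function once it is extended by zero and cut off near the value zero. -/
theorem exists_isBump_of_frontier {p : ℕ∞} (hU : IsOpen U) (hUb : Bornology.IsBounded U)
    (hUne : U.Nonempty) (hf : ContinuousOn f (closure U)) (hfp : ContDiffOn ℝ p f U)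
    (hf0 : ∀ x ∈ frontier U, f x = 0) (hf' : ∀ x ∈ U, fderiv ℝ f x ≠ 0) :
    ∃ b : X → ℝ, IsBump b ∧ ContDiff ℝ p b ∧
      ((∃ K, LipschitzOnWith K f U) → ∃ K, LipschitzWith K b) := by
  obtain ⟨a, haU, ha⟩ : ∃ a ∈ U, f a ≠ 0 := by
    obtain ⟨x, hx⟩ := hUne
    by_contra! h
    have : f =ᶠ[𝓝 x] fun _ => (0 : ℝ) := by
      filter_upwards [hU.mem_nhds hx] with y hy using h y hy
    exact hf' x hx (by rw [this.fderiv_eq, fderiv_fun_const, Pi.zero_apply])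
  -- `S (2 * t / f a - 1)` vanishes for `t` near `0` and equals `1` at `t = f a`
  let b : X → ℝ := fun x => Real.smoothTransition (2 / f a * U.indicator f x - 1)
  have hb0 : ∀ x ∉ U, b x = 0 := fun x hx => by
    simp only [b, indicator_of_notMem hx]
    exact Real.smoothTransition.zero_of_nonpos (by norm_num)
  refine ⟨b, ⟨⟨a, ?_⟩, ?_⟩, ?_, ?_⟩
  · simp only [b, indicator_of_mem haU, Real.smoothTransition.ne_zero_iff]
    rw [div_mul_cancel₀ _ ha]
    norm_num
  · refine hUb.closure.subset (closure_mono fun x hx => ?_)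
    by_contra h
    exact hx (hb0 x h)
  · rw [contDiff_iff_contDiffAt]
    intro x
    by_cases hx : x ∈ U
    · have h1 : b =ᶠ[𝓝 x] fun y => Real.smoothTransition (2 / f a * f y - 1) := by
        filter_upwards [hU.mem_nhds hx] with y hy
        simp only [b, indicator_of_mem hy]
      refine ContDiffAt.congr_of_eventuallyEq ?_ h1
      exact Real.smoothTransition.contDiffAt.comp x
        ((contDiffAt_const.mul (hfp.contDiffAt (hU.mem_nhds hx))).sub contDiffAt_const)
    · refine (contDiffAt_const (c := (0 : ℝ))).congr_of_eventuallyEq ?_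
      have h2 : 0 < |f a| / 2 := half_pos (abs_pos.2 ha)
      filter_upwards [eventually_lt_of_frontier hU hf hf0 hx h2] with y hy
      by_cases hyU : y ∈ U
      · refine Real.smoothTransition.zero_of_nonpos ?_
        rw [indicator_of_mem hyU, sub_nonpos]
        refine (le_abs_self _).trans ?_
        rw [abs_mul, abs_div, abs_two, div_mul_eq_mul_div, div_le_one (abs_pos.2 ha)]
        linarith [hy hyU]
      · exact hb0 y hyU
  · rintro ⟨K, hK⟩
    obtain ⟨L, hL⟩ := Real.smoothTransition.exists_lipschitzWith
    exact ⟨_, hL.comp (((lipschitzWith_smul (2 / f a)).comp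
      (lipschitzWith_indicator_of_frontier hU hf hf0 hK)).sub (LipschitzWith.const 1))⟩

end Extension

end Construction

theorem corollary1p2 {X : Type*} [NormedAddCommGroup X] [NormedSpace ℝ X] [CompleteSpace X]
    (hX : ¬ FiniteDimensional ℝ X) (p : ℕ∞) (hp : 1 ≤ p) :
    -- the `C^p` smooth version
    List.TFAE [
      ∃ b : X → ℝ, IsBump b ∧ ContDiff ℝ p b,
      ∃ (U : Set X) (f : X → ℝ), IsOpen U ∧ Bornology.IsBounded U ∧ ContractibleSpace U ∧
        ContinuousOn f (closure U) ∧ ContDiffOn ℝ p f U ∧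
        (∀ x ∈ frontier U, f x = 0) ∧ ∀ x ∈ U, fderiv ℝ f x ≠ 0,
      ∃ (f : X → ℝ) (U : Set X), ContDiff ℝ p f ∧ (∀ x, f x ∈ Set.Icc (0 : ℝ) 1) ∧
        IsOpen U ∧ Bornology.IsBounded U ∧ ContractibleSpace U ∧
        (∀ x, f x = 0 ↔ x ∈ Uᶜ) ∧ ∀ x ∈ U, fderiv ℝ f x ≠ 0] ∧
    -- the `C^p` smooth and Lipschitz version
    List.TFAE [
      ∃ b : X → ℝ, IsBump b ∧ ContDiff ℝ p b ∧ ∃ K, LipschitzWith K b,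
      ∃ (U : Set X) (f : X → ℝ), IsOpen U ∧ Bornology.IsBounded U ∧ ContractibleSpace U ∧
        ContinuousOn f (closure U) ∧ ContDiffOn ℝ p f U ∧ (∃ K, LipschitzOnWith K f U) ∧
        (∀ x ∈ frontier U, f x = 0) ∧ ∀ x ∈ U, fderiv ℝ f x ≠ 0,
      ∃ (f : X → ℝ) (U : Set X), ContDiff ℝ p f ∧ (∃ K, LipschitzWith K f) ∧
        (∀ x, f x ∈ Set.Icc (0 : ℝ) 1) ∧
        IsOpen U ∧ Bornology.IsBounded U ∧ ContractibleSpace U ∧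
        (∀ x, f x = 0 ↔ x ∈ Uᶜ) ∧ ∀ x ∈ U, fderiv ℝ f x ≠ 0] := by

  have tube : ∀ b : X → ℝ, IsBump b → ContDiff ℝ p b → ∃ (f : X → ℝ) (U : Set X),
      ContDiff ℝ p f ∧ ((∃ K, LipschitzWith K b) → ∃ K, LipschitzWith K f) ∧
      (∀ x, f x ∈ Set.Icc (0 : ℝ) 1) ∧
      IsOpen U ∧ Bornology.IsBounded U ∧ ContractibleSpace U ∧
      (∀ x, f x = 0 ↔ x ∈ Uᶜ) ∧ ∀ x ∈ U, fderiv ℝ f x ≠ 0 := by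
    intro b hb hbp
    obtain ⟨T, hT⟩ := hb.exists_helicalTube hX hbp
    exact ⟨T.toFun, {x | T.toFun x ≠ 0}, T.contDiff_toFun,
      fun h => T.exists_lipschitzWith_toFun hp (hT h), T.toFun_mem_Icc,
      isOpen_ne_fun T.contDiff_toFun.continuous continuous_const, T.isBounded_tube,
      T.contractibleSpace, fun x => not_not.symm, fun x hx => T.fderiv_toFun_ne_zero hp hx⟩
  have frontier_zero : ∀ (f : X → ℝ) (U : Set X), IsOpen U → (∀ x, f x = 0 ↔ x ∈ Uᶜ) →
      ∀ x ∈ frontier U, f x = 0 := fun f U hU h x hx =>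
    (h x).2 (hU.frontier_eq ▸ hx : x ∈ closure U \ U).2
  constructor
  · tfae_have 1 → 3 := by
      rintro ⟨b, hb, hbp⟩
      obtain ⟨f, U, h1, -, h2⟩ := tube b hb hbp
      exact ⟨f, U, h1, h2⟩
    tfae_have 3 → 2 := by
      rintro ⟨f, U, h1, -, h3, h4, h5, h6, h7⟩
      exact ⟨U, f, h3, h4, h5, h1.continuous.continuousOn, h1.contDiffOn,
        frontier_zero f U h3 h6, h7⟩
    tfae_have 2 → 1 := by
      rintro ⟨U, f, h1, h2, h3, h4, h5, h6, h7⟩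
      obtain ⟨b, hb, hbp, -⟩ :=
        exists_isBump_of_frontier h1 h2 (nonempty_coe_sort.1 inferInstance) h4 h5 h6 h7
      exact ⟨b, hb, hbp⟩
    tfae_finish
  · tfae_have 1 → 3 := by
      rintro ⟨b, hb, hbp, hbl⟩
      obtain ⟨f, U, h1, hl, h2⟩ := tube b hb hbp
      exact ⟨f, U, h1, hl hbl, h2⟩
    tfae_have 3 → 2 := by
      rintro ⟨f, U, h1, ⟨K, hK⟩, -, h3, h4, h5, h6, h7⟩
      exact ⟨U, f, h3, h4, h5, h1.continuous.continuousOn, h1.contDiffOn, ⟨K, hK.lipschitzOnWith⟩,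
        frontier_zero f U h3 h6, h7⟩
    tfae_have 2 → 1 := by
      rintro ⟨U, f, h1, h2, h3, h4, h5, hl, h6, h7⟩
      obtain ⟨b, hb, hbp, hbl⟩ :=
        exists_isBump_of_frontier h1 h2 (nonempty_coe_sort.1 inferInstance) h4 h5 h6 h7
      exact ⟨b, hb, hbp, hbl hl⟩
    tfae_finish
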